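/- Let $p$ be an odd prime, let $\mathbb Z_{(p)}$ be the ring of rational numbers whose denominator (in lowest terms) is not divisible by $p$, and let $u\in\mathbb Z_{(p)}$. For rational numbers $a,b$ and $m\in\{p,p^2\}$ write $a\equiv b\pmod m$ if $a-b\in m\,\mathbb Z_{(p)}$. (i) If $u\not\equiv \frac14 \pmod p$, $u\not\equiv\frac1{16}\pmod p$ and $$\sum_{k=0}^{p-1}\binom{2k}k^2\binom{3k}k\left(\frac{u^2}{(1-4u)^3}\right)^k\equiv 0\pmod p,$$ then $$\sum_{k=0}^{p-1}\binom{2k}k^2\binom{3k}k\left(\frac{-u}{(1-16u)^3}\right)^k\equiv 0\pmod{p^2}.$$ (ii) If $u\not\equiv -\frac13\pmod p$, $u\not\equiv-\frac1{27}\pmod p$ and $$\sum_{k=0}^{p-1}\binom{2k}k^2\binom{4k}{2k}\left(\frac{u^3}{(1+3u)^4}\right)^k\equiv 0\pmod p,$$ then $$\sum_{k=0}^{p-1}\binom{2k}k^2\binom{4k}{2k}\left(\frac{u}{(1+27u)^4}\right)^k\equiv 0\pmod{p^2}.$$ (For $p=3$ the two non-congruences in (ii) hold for every $u\in\mathbb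 Z_{(3)}$.) -/

import Mathlib

/-- The rational number `x` lies in `ℤ_(p)`: its denominator in lowest terms is not divisible
by `p`. -/
def PIntegral (p : ℕ) (x : ℚ) : Prop := ¬ p ∣ x.den

/-- Congruence of rational numbers modulo `m` with respect to `ℤ_(p)`: the difference `a - b`
lies in `m ℤ_(p)`. It is used for `m = p` and `m = p ^ 2`. -/
def PCong (p m : ℕ) (a b : ℚ) : Prop := ∃ c : ℚ, PIntegral p c ∧ a - b = (m : ℚ) * c

/-- The sum `∑_{k=0}^{p-1} C(2k,k)² C(3k,k) x^k`. -/
def cubicSum (p : ℕ) (x : ℚ) : ℚ :=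
  ∑ k ∈ Finset.range p, ((2 * k).choose k : ℚ) ^ 2 * ((3 * k).choose k : ℚ) * x ^ k

/-- The sum `∑_{k=0}^{p-1} C(2k,k)² C(4k,2k) x^k`. -/
def quarticSum (p : ℕ) (x : ℚ) : ℚ :=
  ∑ k ∈ Finset.range p, ((2 * k).choose k : ℚ) ^ 2 * ((4 * k).choose (2 * k) : ℚ) * x ^ k

/-
Write `θ = X d/dX`. Both series `S = ∑ c_k X^k` satisfy a third order equation `L S = 0` that is
the symmetric square of a second order one, hence they carry a quadratic first integral `J` with
`θ J = 2 S L S`. For the truncated series `L S` is divisible by `p³`, so `J` vanishes modulo `p²`;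
where `S(T) ≡ 0 (mod p)` this forces `θS(T) ≡ 0` and then, since a root of `S` modulo `p` has
multiplicity at most two, `S(T) ≡ 0 (mod p²)`.

The two rational arguments in `u` are matched modulo `p`: multiplied by suitable powers of
`1 - m u`, both truncated series become polynomial solutions of degree less than `p` of the same
Apéry-like equation, and such a solution is determined by its constant term.

The argument breaks down where `p` divides the leading coefficient `1 - 2 h T` of `L`. Its
numerator as a function of `u` has a squared factor, which is harmless, and a second factor: in the
cubic case it is a unit by hypothesis, and in the quartic case it is `1 + 14 u + 81 u²`. A root
of the latter makes `-2` a square modulo `p`, so that `⌊p / 4⌋` is even, while `S` modulo `p`, of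
degree `⌊p / 4⌋`, would have one simple root and otherwise only double roots.
-/

open Polynomial

section EulerDerivation

variable {R : Type*} [CommRing R]

/-- The Euler derivation `θ = X d/dX` of `R[X]`. -/
noncomputable def theta : Derivation R R[X] R[X] := mkDerivation R X

lemma theta_X : theta (X : R[X]) = X := by rw [theta, mkDerivation_X]

lemma theta_C (a : R) : theta (C a) = 0 := by
  rw [theta, mkDerivation_apply, derivative_C, zero_smul]

lemma theta_apply (y : R[X]) : theta y = X * derivative y := by
  rw [theta, mkDerivation_apply, smul_eq_mul, mul_comm]

lemma coeff_theta (y : R[X]) (n : ℕ) : (theta y).coeff n = n * y.coeff n := by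
  cases n with
  | zero => simp [theta_apply]
  | succ n => rw [theta_apply, coeff_X_mul, coeff_derivative, mul_comm, Nat.cast_succ]

lemma theta_map {S : Type*} [CommRing S] (f : R →+* S) (y : R[X]) :
    theta (y.map f) = (theta y).map f := by
  simp only [theta_apply, derivative_map, Polynomial.map_mul, map_X]

lemma theta_iterate_map {S : Type*} [CommRing S] (f : R →+* S) (y : R[X]) (i : ℕ) :
    theta^[i] (y.map f) = (theta^[i] y).map f := by
  induction i with
  | zero => rfl
  | succ i ih => rw [Function.iterate_succ_apply', ih, theta_map, Function.iterate_succ_apply']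

lemma natDegree_theta_le (y : R[X]) : (theta y).natDegree ≤ y.natDegree :=
  natDegree_le_iff_coeff_eq_zero.2 fun n hn => by
    rw [coeff_theta, coeff_eq_zero_of_natDegree_lt hn, mul_zero]

/-- The operator `θ³ - X (2θ + 1) (a θ² + a θ + b) + c X² (θ + 1)³` satisfied by Apéry-like
generating functions. The case `c = 0` governs the series whose coefficients satisfy
`ClausenRecurrence`. -/
noncomputable def aperyOp (a b c : R) (y : R[X]) : R[X] :=
  theta (theta (theta y))
    - X * (2 * C a * theta (theta (theta y)) + 3 * C a * theta (theta y)
      + (C a + 2 * C b) * theta y + C b * y)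
    + X ^ 2 * (C c * (theta (theta (theta y)) + 3 * theta (theta y) + 3 * theta y + y))

lemma aperyOp_sum {ι : Type*} (s : Finset ι) (f : ι → R[X]) (a b c : R) :
    aperyOp a b c (∑ i ∈ s, f i) = ∑ i ∈ s, aperyOp a b c (f i) := by
  simp only [aperyOp, map_sum, Finset.mul_sum, ← Finset.sum_add_distrib,
    ← Finset.sum_sub_distrib]

lemma aperyOp_sub (a b c : R) (y z : R[X]) :
    aperyOp a b c (y - z) = aperyOp a b c y - aperyOp a b c z := by
  simp only [aperyOp, map_sub]
  ring

lemma aperyOp_C_mul (a b c : R) (r : R) (y : R[X]) :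
    aperyOp a b c (C r * y) = C r * aperyOp a b c y := by
  simp only [aperyOp, Derivation.leibniz, theta_C, smul_eq_mul, mul_zero, add_zero]
  ring

lemma coeff_zero_aperyOp (a b c : R) (y : R[X]) : (aperyOp a b c y).coeff 0 = 0 := by
  simp [aperyOp, coeff_theta]

lemma coeff_succ_aperyOp_zero (a b : R) (y : R[X]) (n : ℕ) :
    (aperyOp a b 0 y).coeff (n + 1) = (n + 1) ^ 3 * y.coeff (n + 1)
      - (2 * n + 1) * (a * n * (n + 1) + b) * y.coeff n := by
  simp only [aperyOp, coeff_add, coeff_sub, coeff_X_mul, coeff_C_mul, coeff_ofNat_mul,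
    coeff_theta, C_0, zero_mul, mul_zero, coeff_zero, add_mul, mul_assoc]
  push_cast
  ring

lemma coeff_aperyOp_of_forall_lt (a b c : R) {y : R[X]} {n : ℕ} (h : ∀ m < n, y.coeff m = 0) :
    (aperyOp a b c y).coeff n = n ^ 3 * y.coeff n := by
  match n with
  | 0 => simp [coeff_zero_aperyOp]
  | 1 => simp [aperyOp, coeff_theta, coeff_X_pow_mul', h, add_mul, mul_assoc]
  | n + 2 =>
    simp only [aperyOp, mul_assoc, add_mul, coeff_add, coeff_sub, coeff_theta, coeff_X_mul,
      coeff_ofNat_mul, coeff_C_mul, coeff_X_pow_mul', add_tsub_cancel_right, h (n + 1) (by omega),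
      h n (by omega), mul_zero, add_zero, sub_zero, ite_self]
    ring

theorem eq_zero_of_aperyOp_eq_zero [IsDomain R] {p : ℕ} [CharP R p] {a b c : R} {y : R[X]}
    (hdeg : y.degree < p) (h0 : y.coeff 0 = 0) (hy : aperyOp a b c y = 0) : y = 0 := by
  suffices h : ∀ n < p, y.coeff n = 0 by
    ext n
    rcases lt_or_ge n p with hn | hn
    · rw [h n hn, coeff_zero]
    · rw [coeff_eq_zero_of_degree_lt (hdeg.trans_le (by exact_mod_cast hn)), coeff_zero]
  intro n
  induction n using Nat.strong_induction_on with
  | _ n ih =>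
    intro hn
    rcases n.eq_zero_or_pos with rfl | hpos
    · exact h0
    have hcoeff : (n : R) ^ 3 * y.coeff n = 0 := by
      rw [← coeff_aperyOp_of_forall_lt a b c fun m hm => ih m hm (hm.trans hn), hy, coeff_zero]
    have hn0 : (n : R) ≠ 0 := fun h =>
      Nat.not_dvd_of_pos_of_lt hpos hn ((CharP.cast_eq_zero_iff R p n).1 h)
    exact (mul_eq_zero.1 hcoeff).resolve_left (pow_ne_zero 3 hn0)

/-- A first integral of `aperyOp a b 0`, see `theta_firstIntegral`. It is the discriminant-like
quadratic form that a symmetric square of a second order equation carries. -/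
noncomputable def firstIntegral (a b : R) (y : R[X]) : R[X] :=
  (1 - 2 * C a * X) * (2 * y * theta (theta y) - theta y ^ 2)
    - 2 * C a * X * y * theta y - 2 * C b * X * y ^ 2

lemma theta_firstIntegral (a b : R) (y : R[X]) :
    theta (firstIntegral a b y) = 2 * y * aperyOp a b 0 y := by
  simp only [firstIntegral, aperyOp, map_sub, Derivation.leibniz, Derivation.leibniz_pow, theta_X,
    Derivation.map_one_eq_zero, theta_C, smul_eq_mul, nsmul_eq_mul,
    C_0, show theta (2 : R[X]) = 0 from theta_C 2]
  ring

lemma coeff_zero_firstIntegral (a b : R) (y : R[X]) : (firstIntegral a b y).coeff 0 = 0 := by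
  simp [firstIntegral, coeff_theta, mul_coeff_zero, sq]

lemma natDegree_firstIntegral_le (a b : R) (y : R[X]) :
    (firstIntegral a b y).natDegree ≤ 2 * y.natDegree + 1 := by
  have h₁ := natDegree_theta_le y
  have h₂ := (natDegree_theta_le (theta y)).trans h₁
  rw [firstIntegral]
  compute_degree
  omega

lemma eval_firstIntegral (a b t : R) (y : R[X]) : (firstIntegral a b y).eval t =
    (1 - 2 * a * t) * (2 * y.eval t * (theta (theta y)).eval t - (theta y).eval t ^ 2)
      - 2 * a * t * y.eval t * (theta y).eval t - 2 * b * t * y.eval t ^ 2 := by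
  simp [firstIntegral]

lemma firstIntegral_map {S : Type*} [CommRing S] (f : R →+* S) (a b : R) (y : R[X]) :
    firstIntegral (f a) (f b) (y.map f) = (firstIntegral a b y).map f := by
  simp [firstIntegral, theta_map]

end EulerDerivation

section TruncatedSeries

/-- The truncation `∑_{k<n} c k X^k` of the generating function of `c`, with coefficients
in `R`. -/
noncomputable def truncSeries (R : Type*) [CommRing R] (c : ℕ → ℕ) (n : ℕ) : R[X] :=
  PowerSeries.trunc n (PowerSeries.mk fun k => (c k : R))

/-- The first-order recurrence of the series that Clausen's formula writes as squares of
`₂F₁`-series. -/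
def ClausenRecurrence (h d : ℕ) (c : ℕ → ℕ) : Prop :=
  ∀ k, (k + 1) ^ 3 * c (k + 1) = (2 * k + 1) * (h * k * (k + 1) + d) * c k

variable {R : Type*} [CommRing R] {c : ℕ → ℕ} {h d : ℕ}

lemma coeff_truncSeries (c : ℕ → ℕ) (n m : ℕ) :
    (truncSeries R c n).coeff m = if m < n then (c m : R) else 0 := by
  rw [truncSeries, PowerSeries.coeff_trunc, PowerSeries.coeff_mk]

lemma truncSeries_map {S : Type*} [CommRing S] (f : R →+* S) (c : ℕ → ℕ) (n : ℕ) :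
    (truncSeries R c n).map f = truncSeries S c n := by
  ext m
  simp [coeff_truncSeries, apply_ite f]

lemma eval_truncSeries (c : ℕ → ℕ) (n : ℕ) (t : R) :
    (truncSeries R c n).eval t = ∑ k ∈ Finset.range n, (c k : R) * t ^ k := by
  simp [truncSeries, eval, PowerSeries.eval₂_trunc_eq_sum_range]

lemma map_eval_theta_iterate_truncSeries {S : Type*} [CommRing S] (f : R →+* S) (c : ℕ → ℕ)
    (n i : ℕ) (t : R) :
    f ((theta^[i] (truncSeries R c n)).eval t) = (theta^[i] (truncSeries S c n)).eval (f t) := by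
  rw [← truncSeries_map f, theta_iterate_map, eval_map_apply]

lemma eval_zero_truncSeries (hc₀ : c 0 = 1) {n : ℕ} (hn : n ≠ 0) :
    (truncSeries R c n).eval 0 = 1 := by
  rw [← coeff_zero_eq_eval_zero, coeff_truncSeries, if_pos (by omega), hc₀, Nat.cast_one]

lemma truncSeries_ne_zero [Nontrivial R] (hc₀ : c 0 = 1) {n : ℕ} (hn : n ≠ 0) :
    truncSeries R c n ≠ 0 := by
  intro h
  simpa [h] using eval_zero_truncSeries (R := R) hc₀ hn

lemma natDegree_truncSeries_lt (c : ℕ → ℕ) {n : ℕ} (hn : n ≠ 0) :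
    (truncSeries R c n).natDegree < n := by
  obtain ⟨m, rfl⟩ := Nat.exists_eq_succ_of_ne_zero hn
  exact PowerSeries.natDegree_trunc_lt _ m

lemma sq_dvd_of_cube_dvd_natCast_mul {p i : ℕ} (hp : p.Prime) (hpos : 0 < i) (hi : i < p ^ 2)
    {a : ℤ} (ha : (p : ℤ) ^ 3 ∣ i * a) : (p : ℤ) ^ 2 ∣ a := by
  have hpZ : Prime (p : ℤ) := Nat.prime_iff_prime_int.1 hp
  by_cases hpi : p ∣ i
  · obtain ⟨j, rfl⟩ := hpi
    have hj : ¬ (p : ℤ) ∣ j := fun hj => Nat.not_dvd_of_pos_of_lt hpos hi <| by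
      rw [sq]
      exact mul_dvd_mul_left p (Int.natCast_dvd_natCast.1 hj)
    refine hpZ.pow_dvd_of_dvd_mul_left 2 hj ?_
    rwa [Nat.cast_mul, mul_assoc, pow_succ', mul_dvd_mul_iff_left hpZ.ne_zero] at ha
  · exact (pow_dvd_pow _ (by norm_num)).trans <|
      hpZ.pow_dvd_of_dvd_mul_left 3 (mt Int.natCast_dvd_natCast.1 hpi) ha

namespace ClausenRecurrence

lemma aperyOp_truncSeries (hc : ClausenRecurrence h d c) (n : ℕ) :
    aperyOp (h : R) d 0 (truncSeries R c n) = C ((n : R) ^ 3) * (C (-(c n : R)) * X ^ n) := by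
  ext (_ | k)
  · cases n <;> simp [coeff_zero_aperyOp]
  have hk : ((k : R) + 1) ^ 3 * c (k + 1) = (2 * k + 1) * (h * k * (k + 1) + d) * c k := by
    exact_mod_cast congrArg (Nat.cast (R := R)) (hc k)
  rw [coeff_succ_aperyOp_zero, coeff_truncSeries, coeff_truncSeries, coeff_C_mul, coeff_C_mul,
    coeff_X_pow]
  rcases lt_trichotomy (k + 1) n with hlt | rfl | hgt
  · rw [if_pos hlt, if_pos (by omega), if_neg hlt.ne, hk]
    ring
  · rw [if_neg (by omega), if_pos (by omega), if_pos rfl, Nat.cast_succ]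
    linear_combination hk
  · rw [if_neg (by omega), if_neg (by omega), if_neg hgt.ne']
    ring

lemma aperyOp_truncSeries_of_charP (hc : ClausenRecurrence h d c) (p : ℕ) [CharP R p] :
    aperyOp (h : R) d 0 (truncSeries R c p) = 0 := by
  rw [hc.aperyOp_truncSeries, CharP.cast_eq_zero]
  simp

lemma C_cube_dvd_theta_firstIntegral (hc : ClausenRecurrence h d c) (n : ℕ) :
    C ((n : R) ^ 3) ∣ theta (firstIntegral (h : R) d (truncSeries R c n)) := by
  rw [theta_firstIntegral, hc.aperyOp_truncSeries]
  exact (Dvd.intro _ rfl).mul_left _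

lemma C_sq_dvd_firstIntegral (hc : ClausenRecurrence h d c) {p : ℕ} (hp : p.Prime) :
    C ((p : ℤ) ^ 2) ∣ firstIntegral (h : ℤ) d (truncSeries ℤ c p) := by
  set J := firstIntegral (h : ℤ) d (truncSeries ℤ c p) with hJ
  refine (C_dvd_iff_dvd_coeff _ _).2 fun i => ?_
  rcases i.eq_zero_or_pos with rfl | hpos
  · rw [hJ, coeff_zero_firstIntegral]
    exact dvd_zero _
  rcases le_or_gt (p ^ 2) i with hlarge | hsmall
  · have hdeg : J.natDegree < i := calc
      J.natDegree ≤ 2 * (truncSeries ℤ c p).natDegree + 1 := natDegree_firstIntegral_le _ _ _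
      _ < 2 * p := by have := natDegree_truncSeries_lt (R := ℤ) c hp.ne_zero; omega
      _ ≤ p ^ 2 := by rw [sq]; exact Nat.mul_le_mul_right p hp.two_le
      _ ≤ i := hlarge
    rw [coeff_eq_zero_of_natDegree_lt hdeg]
    exact dvd_zero _
  · refine sq_dvd_of_cube_dvd_natCast_mul hp hpos hsmall ?_
    rw [← coeff_theta]
    exact (C_dvd_iff_dvd_coeff _ _).1 (hc.C_cube_dvd_theta_firstIntegral p) i

lemma firstIntegral_eq_zero (hc : ClausenRecurrence h d c) {p : ℕ} (hp : p.Prime) [CharP R p] :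
    firstIntegral (h : R) d (truncSeries R c p) = 0 := by
  obtain ⟨g, hg⟩ := hc.C_sq_dvd_firstIntegral hp
  have := firstIntegral_map (Int.castRingHom R) (h : ℤ) d (truncSeries ℤ c p)
  rw [truncSeries_map, hg] at this
  simpa using this

lemma sq_dvd_eval_firstIntegral (hc : ClausenRecurrence h d c) {p : ℕ} (hp : p.Prime) (t : R) :
    (p : R) ^ 2 ∣ (firstIntegral (h : R) d (truncSeries R c p)).eval t := by
  obtain ⟨g, hg⟩ := hc.C_sq_dvd_firstIntegral hp
  have := firstIntegral_map (Int.castRingHom R) (h : ℤ) d (truncSeries ℤ c p)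
  rw [truncSeries_map, hg] at this
  refine ⟨(g.map (Int.castRingHom R)).eval t, ?_⟩
  simpa using congrArg (eval t) this

end ClausenRecurrence

end TruncatedSeries

section LocalExponents

section CommRing

variable {R : Type*} [CommRing R]

lemma theta_X_sub_C (r : R) : theta (X - C r) = X := by
  rw [map_sub, theta_X, theta_C, sub_zero]

lemma X_sub_C_mul_theta_pow_mul (r : R) (m : ℕ) (z : R[X]) :
    (X - C r) * theta ((X - C r) ^ m * z) =
      (X - C r) ^ m * ((m : R[X]) * X * z + (X - C r) * theta z) := by
  cases m <;>
    simp only [Derivation.leibniz, Derivation.leibniz_pow, theta_X_sub_C, smul_eq_mul,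
      nsmul_eq_mul, Nat.add_sub_cancel, pow_zero, Derivation.map_one_eq_zero, Nat.cast_zero] <;>
    ring

lemma X_sub_C_pow_mul_theta_iterate (r : R) (m i : ℕ) (z : R[X]) :
    ∃ v : R[X], (X - C r) ^ i * theta^[i] ((X - C r) ^ m * z) =
      (X - C r) ^ m * (C (m.descFactorial i : R) * X ^ i * z + (X - C r) * v) := by
  induction i with
  | zero => exact ⟨0, by simp⟩
  | succ i ih =>
    obtain ⟨v, hv⟩ := ih
    set g := theta^[i] ((X - C r) ^ m * z)
    set b := C (m.descFactorial i : R) * X ^ i * z + (X - C r) * v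
    have hstep : (X - C r) ^ (i + 1) * theta g =
        (X - C r) * theta ((X - C r) ^ i * g) - (i : R[X]) * X * ((X - C r) ^ i * g) := by
      rw [X_sub_C_mul_theta_pow_mul]
      ring
    have hdesc : (m.descFactorial (i + 1) : R) = m.descFactorial i * (m - i) := by
      simp only [← descPochhammer_eval_eq_descFactorial R, descPochhammer_succ_eval]
    refine ⟨theta b + C (m - i : R) * X * v, ?_⟩
    rw [Function.iterate_succ_apply', hstep, hv, X_sub_C_mul_theta_pow_mul, hdesc]
    simp only [b, C_mul, C_sub, C_eq_natCast]
    ring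

/-- The leading terms at `r` of the operator: the exponents there are the roots of
`m (m - 1) (m - 2)`, unless the symbol `1 - 2 a X + c X²` of the operator vanishes at `r`. -/
lemma X_sub_C_pow_mul_aperyOp (a b c r : R) (m : ℕ) (z : R[X]) :
    ∃ v w : R[X], (X - C r) ^ 3 * aperyOp a b c ((X - C r) ^ m * z) = (X - C r) ^ m *
      ((1 - 2 * C a * X + C c * X ^ 2) *
          (C (m.descFactorial 3 : R) * X ^ 3 * z + (X - C r) * v)
        - 3 * (C a * X - C c * X ^ 2) * (X - C r) * (C (m.descFactorial 2 : R) * X ^ 2 * z)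
        + (X - C r) ^ 2 * w) := by
  obtain ⟨v₁, h₁⟩ := X_sub_C_pow_mul_theta_iterate r m 1 z
  obtain ⟨v₂, h₂⟩ := X_sub_C_pow_mul_theta_iterate r m 2 z
  obtain ⟨v₃, h₃⟩ := X_sub_C_pow_mul_theta_iterate r m 3 z
  simp only [Function.iterate_succ_apply, Function.iterate_zero_apply] at h₁ h₂ h₃
  refine ⟨v₃, -3 * (C a * X - C c * X ^ 2) * v₂
    - ((C a + 2 * C b) * X - 3 * C c * X ^ 2) *
      (C (m.descFactorial 1 : R) * X ^ 1 * z + (X - C r) * v₁)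
    - (C b * X - C c * X ^ 2) * (X - C r) * z, ?_⟩
  rw [aperyOp]
  linear_combination (1 - 2 * C a * X + C c * X ^ 2) * h₃
    - 3 * (C a * X - C c * X ^ 2) * (X - C r) * h₂
    - ((C a + 2 * C b) * X - 3 * C c * X ^ 2) * (X - C r) ^ 2 * h₁

lemma exists_eq_X_sub_C_pow_mul {y : R[X]} (hy : y ≠ 0) (r : R) :
    ∃ z : R[X], y = (X - C r) ^ y.rootMultiplicity r * z ∧ z.eval r ≠ 0 := by
  obtain ⟨z, hz, hdvd⟩ := exists_eq_pow_rootMultiplicity_mul_and_not_dvd y hy r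
  exact ⟨z, hz, mt dvd_iff_isRoot.2 hdvd⟩

lemma natCast_descFactorial_ne_zero {p : ℕ} (hp : p.Prime) [CharP R p] {m i : ℕ}
    (hm : m < p) (hi : i ≤ m) :
    (m.descFactorial i : R) ≠ 0 := by
  rw [Ne, CharP.cast_eq_zero_iff R p]
  intro h
  have := h.trans (Dvd.intro_left _ (Nat.factorial_mul_descFactorial hi))
  exact hm.not_ge (hp.dvd_factorial.1 this)

end CommRing

section Domain

variable {K : Type*} [CommRing K] [IsDomain K] {r : K} {y : K[X]}

lemma rootMultiplicity_le_natDegree (hy : y ≠ 0) (r : K) : y.rootMultiplicity r ≤ y.natDegree := by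
  simpa using natDegree_le_of_dvd (pow_rootMultiplicity_dvd y r) hy

lemma descFactorial_rootMultiplicity_eq_zero {a b c : K} (hy : y ≠ 0) (hL : aperyOp a b c y = 0)
    (hr : r ≠ 0) (hsymb : 1 - 2 * a * r + c * r ^ 2 ≠ 0) :
    ((y.rootMultiplicity r).descFactorial 3 : K) = 0 := by
  obtain ⟨z, hyz, hz⟩ := exists_eq_X_sub_C_pow_mul hy r
  obtain ⟨v, w, h⟩ := X_sub_C_pow_mul_aperyOp a b c r (y.rootMultiplicity r) z
  rw [← hyz, hL, mul_zero, eq_comm, mul_eq_zero] at h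
  have := congrArg (eval r) (h.resolve_left (pow_ne_zero _ (X_sub_C_ne_zero r)))
  simpa [hsymb, hr, hz] using this

lemma indicial_rootMultiplicity_eq_zero {a b : K} (hy : y ≠ 0) (hL : aperyOp a b 0 y = 0)
    (hr : 2 * a * r = 1) :
    (2 * (y.rootMultiplicity r).descFactorial 3 + 3 * (y.rootMultiplicity r).descFactorial 2 : K)
      = 0 := by
  obtain ⟨z, hyz, hz⟩ := exists_eq_X_sub_C_pow_mul hy r
  obtain ⟨v, w, h⟩ := X_sub_C_pow_mul_aperyOp a b 0 r (y.rootMultiplicity r) z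
  rw [← hyz, hL, mul_zero, eq_comm, mul_eq_zero] at h
  set m := y.rootMultiplicity r
  have hsymb : (1 - 2 * C a * X : K[X]) = -2 * C a * (X - C r) := by
    have hC : (2 * C a * C r : K[X]) = 1 := by
      rw [← C_1, ← hr, C_mul, C_mul, map_ofNat]
    linear_combination -hC
  have hfactor : (X - C r) * (-2 * C a *
      (C (m.descFactorial 3 : K) * X ^ 3 * z + (X - C r) * v)
        - 3 * C a * X * (C (m.descFactorial 2 : K) * X ^ 2 * z) + (X - C r) * w) = 0 := by
    have h' := h.resolve_left (pow_ne_zero _ (X_sub_C_ne_zero r))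
    simp only [C_0, zero_mul, add_zero, sub_zero] at h'
    rw [hsymb] at h'
    linear_combination h'
  have heval := congrArg (eval r) ((mul_eq_zero.1 hfactor).resolve_left (X_sub_C_ne_zero r))
  have hr₀ : a ≠ 0 ∧ r ≠ 0 := by
    constructor <;> rintro rfl <;> simp at hr
  have hprod : a * r ^ 3 * z.eval r *
      (2 * (m.descFactorial 3 : K) + 3 * (m.descFactorial 2 : K)) = 0 := by
    simp only [eval_add, eval_sub, eval_mul, eval_pow, eval_X, eval_C, eval_neg, eval_ofNat,
      sub_self, zero_mul, add_zero, eval_zero] at heval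
    linear_combination -heval
  exact (mul_eq_zero.1 hprod).resolve_left
    (mul_ne_zero (mul_ne_zero hr₀.1 (pow_ne_zero 3 hr₀.2)) hz)

variable {p : ℕ} [CharP K p]

lemma eval_theta_iterate_rootMultiplicity_ne_zero (hp : p.Prime) (hy : y ≠ 0)
    (hdeg : y.natDegree < p) (hr : r ≠ 0) :
    (theta^[y.rootMultiplicity r] y).eval r ≠ 0 := by
  obtain ⟨z, hyz, hz⟩ := exists_eq_X_sub_C_pow_mul hy r
  obtain ⟨v, h⟩ := X_sub_C_pow_mul_theta_iterate r (y.rootMultiplicity r) (y.rootMultiplicity r) z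
  rw [← hyz, mul_right_inj' (pow_ne_zero _ (X_sub_C_ne_zero r))] at h
  have := natCast_descFactorial_ne_zero (R := K) hp
    ((rootMultiplicity_le_natDegree hy r).trans_lt hdeg) le_rfl
  rw [h]
  simp [hr, hz, this]

lemma rootMultiplicity_eq_two {a b c : K} (hp : p.Prime) (hy : y ≠ 0) (hdeg : y.natDegree < p)
    (hL : aperyOp a b c y = 0) (hr : r ≠ 0) (hsymb : 1 - 2 * a * r + c * r ^ 2 ≠ 0)
    (h₀ : y.eval r = 0) (h₁ : (theta y).eval r = 0) : y.rootMultiplicity r = 2 := by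
  have hlead := eval_theta_iterate_rootMultiplicity_ne_zero hp hy hdeg hr
  have hlt : y.rootMultiplicity r < p := (rootMultiplicity_le_natDegree hy r).trans_lt hdeg
  have hthree : ¬ 3 ≤ y.rootMultiplicity r := fun h =>
    natCast_descFactorial_ne_zero hp hlt h (descFactorial_rootMultiplicity_eq_zero hy hL hr hsymb)
  generalize y.rootMultiplicity r = m at hlead hthree
  match m with
  | 0 => exact absurd h₀ hlead
  | 1 => exact absurd h₁ hlead
  | 2 => rfl
  | m + 3 => omega

lemma rootMultiplicity_eq_one {a b : K} (hp : p.Prime) (hy : y ≠ 0) (hdeg : 2 * y.natDegree ≤ p)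
    (hL : aperyOp a b 0 y = 0) (hr : 2 * a * r = 1) (h₀ : y.eval r = 0) :
    y.rootMultiplicity r = 1 := by
  have hpos : 0 < y.rootMultiplicity r := (rootMultiplicity_pos hy).2 h₀
  have hle := rootMultiplicity_le_natDegree hy r
  have hind := indicial_rootMultiplicity_eq_zero hy hL hr
  generalize y.rootMultiplicity r = m at *
  by_contra hne
  obtain ⟨n, rfl⟩ : ∃ n, m = n + 2 := ⟨m - 2, by omega⟩
  have hfac : 2 * (n + 2).descFactorial 3 + 3 * (n + 2).descFactorial 2 =
      (n + 2) * (n + 1) * (2 * n + 3) := by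
    simp only [Nat.descFactorial_succ, Nat.descFactorial_zero, Nat.add_sub_cancel, Nat.sub_zero,
      show n + 2 - 1 = n + 1 from rfl]
    ring
  have hzero : (((n + 2) * (n + 1) * (2 * n + 3) : ℕ) : K) = 0 := by
    rw [← hfac]
    exact_mod_cast hind
  rw [CharP.cast_eq_zero_iff K p, hp.dvd_mul, hp.dvd_mul] at hzero
  rcases hzero with (h | h) | h <;> have := Nat.le_of_dvd (by omega) h <;> omega

lemma eval_theta_theta_ne_zero {a b c : K} (hp : p.Prime) (hy : y ≠ 0) (hdeg : y.natDegree < p)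
    (hL : aperyOp a b c y = 0) (hr : r ≠ 0) (hsymb : 1 - 2 * a * r + c * r ^ 2 ≠ 0)
    (h₀ : y.eval r = 0) (h₁ : (theta y).eval r = 0) : (theta (theta y)).eval r ≠ 0 := by
  have hlead := eval_theta_iterate_rootMultiplicity_ne_zero hp hy hdeg hr
  rwa [rootMultiplicity_eq_two hp hy hdeg hL hr hsymb h₀ h₁] at hlead

lemma eval_theta_ne_zero {a b : K} (hp : p.Prime) (hy : y ≠ 0) (hdeg : 2 * y.natDegree ≤ p)
    (hL : aperyOp a b 0 y = 0) (hr : 2 * a * r = 1) (h₀ : y.eval r = 0) :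
    (theta y).eval r ≠ 0 := by
  have hpos := hp.pos
  have hlead := eval_theta_iterate_rootMultiplicity_ne_zero (r := r) hp hy (by omega)
    (right_ne_zero_of_mul_eq_one hr)
  rwa [rootMultiplicity_eq_one hp hy hdeg hL hr h₀] at hlead

end Domain

end LocalExponents

section OddDegree

variable {K : Type*} [CommRing K] [IsDomain K] {p : ℕ} [CharP K p] {y : K[X]} {r : K}

/-- The singular point `r` is a simple root, and since the first integral vanishes all other
roots are double. -/
lemma odd_natDegree_of_eval_eq_zero {a b : K} (hp : p.Prime) (hsplits : y.Splits)
    (hdeg : 2 * y.natDegree ≤ p) (hL : aperyOp a b 0 y = 0) (hJ : firstIntegral a b y = 0)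
    (hy₀ : y.eval 0 ≠ 0) (hr : 2 * a * r = 1) (h₀ : y.eval r = 0) : Odd y.natDegree := by
  classical
  have hy : y ≠ 0 := by
    rintro rfl
    simp at hy₀
  have hdeg' : y.natDegree < p := by
    have := hp.pos
    omega
  have hdouble : ∀ s ∈ y.roots.toFinset.erase r, y.roots.count s = 2 := by
    intro s hs
    rw [Finset.mem_erase, Multiset.mem_toFinset, mem_roots hy, IsRoot.def] at hs
    have hsymb : 1 - 2 * a * s ≠ 0 := fun h => hs.1 <| by
      have ha : 2 * a ≠ 0 := left_ne_zero_of_mul_eq_one hr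
      exact mul_left_cancel₀ ha (by linear_combination -h - hr)
    have hs₁ : (theta y).eval s = 0 := by
      have := congrArg (eval s) hJ
      simpa [firstIntegral, hs.2, hsymb] using this
    rw [count_roots]
    refine rootMultiplicity_eq_two hp hy hdeg' hL ?_ (by simpa using hsymb) hs.2 hs₁
    rintro rfl
    exact hy₀ hs.2
  have hmem : r ∈ y.roots.toFinset := Multiset.mem_toFinset.2 ((mem_roots hy).2 h₀)
  rw [hsplits.natDegree_eq_card_roots, ← Multiset.toFinset_sum_count_eq,
    ← Finset.add_sum_erase _ _ hmem, Finset.sum_congr rfl hdouble, count_roots,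
    rootMultiplicity_eq_one hp hy hdeg hL hr h₀, Finset.sum_const, smul_eq_mul, add_comm]
  exact (even_two.mul_left _).add_one

end OddDegree

section Supercongruence

variable {p : ℕ} [Fact p.Prime] {c : ℕ → ℕ} {h d : ℕ}

lemma toZMod_eq_zero_iff_dvd {x : ℤ_[p]} : PadicInt.toZMod x = 0 ↔ (p : ℤ_[p]) ∣ x := by
  rw [← RingHom.mem_ker, PadicInt.ker_toZMod, PadicInt.maximalIdeal_eq_span_p,
    Ideal.mem_span_singleton]

lemma not_dvd_two (hodd : Odd p) : ¬ (p : ℤ_[p]) ∣ 2 := by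
  rw [← toZMod_eq_zero_iff_dvd, map_ofNat]
  intro h
  have h' : p ∣ 2 := (ZMod.natCast_eq_zero_iff 2 p).1 h
  obtain rfl := (Nat.prime_dvd_prime_iff_eq Fact.out Nat.prime_two).1 h'
  exact absurd hodd (by decide)

lemma dvd_eval_theta_iterate_iff (c : ℕ → ℕ) (i : ℕ) (T : ℤ_[p]) :
    (p : ℤ_[p]) ∣ (theta^[i] (truncSeries ℤ_[p] c p)).eval T ↔
      (theta^[i] (truncSeries (ZMod p) c p)).eval (PadicInt.toZMod T) = 0 := by
  rw [← toZMod_eq_zero_iff_dvd, map_eval_theta_iterate_truncSeries]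

section

variable (hodd : Odd p) (hc : ClausenRecurrence h d c) (hc₀ : c 0 = 1) {T : ℤ_[p]}
  (hT : (p : ℤ_[p]) ∣ (truncSeries ℤ_[p] c p).eval T)

include hc₀ hT

lemma toZMod_ne_zero : PadicInt.toZMod T ≠ 0 := by
  intro hr
  have h₀ := (dvd_eval_theta_iterate_iff c 0 T).1 hT
  rw [hr, Function.iterate_zero_apply,
    eval_zero_truncSeries hc₀ (Nat.Prime.ne_zero Fact.out)] at h₀
  exact one_ne_zero h₀

include hc

lemma sq_dvd_eval_truncSeries_of_singular
    (hdeg : 2 * (truncSeries (ZMod p) c p).natDegree ≤ p)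
    (hsing : (p : ℤ_[p]) ^ 2 ∣ 1 - 2 * (h : ℤ_[p]) * T) :
    (p : ℤ_[p]) ^ 2 ∣ (truncSeries ℤ_[p] c p).eval T := by
  have hp : p.Prime := Fact.out
  have hπ : Prime (p : ℤ_[p]) := PadicInt.prime_p
  obtain ⟨J, hJ⟩ := hc.sq_dvd_eval_firstIntegral hp T
  rw [eval_firstIntegral] at hJ
  have hr : 2 * (h : ZMod p) * PadicInt.toZMod T = 1 := by
    have := toZMod_eq_zero_iff_dvd.2 ((dvd_pow_self _ two_ne_zero).trans hsing)
    simp only [map_sub, map_mul, map_one, map_ofNat, map_natCast] at this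
    exact (sub_eq_zero.1 this).symm
  have hs₁ := eval_theta_ne_zero hp (truncSeries_ne_zero hc₀ hp.ne_zero) hdeg
    (hc.aperyOp_truncSeries_of_charP p) hr ((dvd_eval_theta_iterate_iff c 0 T).1 hT)
  have h₁ := dvd_eval_theta_iterate_iff c 1 T
  simp only [Function.iterate_succ_apply, Function.iterate_zero_apply] at h₁
  rw [Ne, ← h₁] at hs₁
  obtain ⟨q₀, hq₀⟩ := hT
  obtain ⟨e, he⟩ := hsing
  set S := truncSeries ℤ_[p] c p
  have hunit : ¬ (p : ℤ_[p]) ∣ 2 * (h : ℤ_[p]) * T := by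
    rw [← toZMod_eq_zero_iff_dvd, map_mul, map_mul, map_ofNat, map_natCast, hr]
    exact one_ne_zero
  refine hπ.pow_dvd_of_dvd_mul_left 2 (hπ.not_dvd_mul hunit hs₁) ?_
  refine ⟨e * (2 * S.eval T * (theta (theta S)).eval T - (theta S).eval T ^ 2)
    - 2 * d * T * q₀ ^ 2 - J, ?_⟩
  rw [he] at hJ
  linear_combination -hJ - 2 * d * T * (S.eval T + p * q₀) * hq₀

include hodd

lemma sq_dvd_eval_truncSeries_of_regular (hreg : ¬ (p : ℤ_[p]) ∣ 1 - 2 * (h : ℤ_[p]) * T) :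
    (p : ℤ_[p]) ^ 2 ∣ (truncSeries ℤ_[p] c p).eval T := by
  have hp : p.Prime := Fact.out
  have hπ : Prime (p : ℤ_[p]) := PadicInt.prime_p
  obtain ⟨J, hJ⟩ := hc.sq_dvd_eval_firstIntegral hp T
  rw [eval_firstIntegral] at hJ
  have hsymb : 1 - 2 * (h : ZMod p) * PadicInt.toZMod T + 0 * PadicInt.toZMod T ^ 2 ≠ 0 := by
    rw [← toZMod_eq_zero_iff_dvd] at hreg
    simpa only [map_sub, map_mul, map_one, map_ofNat, map_natCast, zero_mul, add_zero] using hreg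
  have hs₂ := eval_theta_theta_ne_zero (r := PadicInt.toZMod T) hp
    (truncSeries_ne_zero hc₀ hp.ne_zero) (natDegree_truncSeries_lt c hp.ne_zero)
    (hc.aperyOp_truncSeries_of_charP p) (toZMod_ne_zero hc₀ hT)
    hsymb ((dvd_eval_theta_iterate_iff c 0 T).1 hT)
  have h₁ := dvd_eval_theta_iterate_iff c 1 T
  have h₂ := dvd_eval_theta_iterate_iff c 2 T
  simp only [Function.iterate_succ_apply, Function.iterate_zero_apply] at h₁ h₂
  rw [← h₁, Ne, ← h₂] at hs₂
  obtain ⟨q₀, hq₀⟩ := hT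
  set S := truncSeries ℤ_[p] c p
  have hs₁ : (p : ℤ_[p]) ∣ (theta S).eval T := by
    refine hπ.dvd_of_dvd_pow (n := 2)
      ((hπ.dvd_or_dvd (a := 1 - 2 * (h : ℤ_[p]) * T) ?_).resolve_left hreg)
    refine ⟨(1 - 2 * h * T) * 2 * q₀ * (theta (theta S)).eval T - 2 * h * T * q₀ * (theta S).eval T
      - 2 * d * T * q₀ * S.eval T - p * J, ?_⟩
    rw [hq₀] at hJ ⊢
    linear_combination -hJ
  obtain ⟨q₁, hq₁⟩ := id hs₁
  refine hπ.pow_dvd_of_dvd_mul_left 2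
    (a := (1 - 2 * (h : ℤ_[p]) * T) * 2 * (theta (theta S)).eval T) ?_ ?_
  · exact hπ.not_dvd_mul (hπ.not_dvd_mul hreg (not_dvd_two hodd)) (hs₂ hs₁)
  · refine ⟨J + (1 - 2 * h * T) * q₁ ^ 2 + 2 * h * T * q₀ * q₁ + 2 * d * T * q₀ ^ 2, ?_⟩
    rw [hq₀, hq₁] at hJ
    rw [hq₀]
    linear_combination hJ

end

/-- The value at `T` of the first integral is `0` modulo `p²`, which turns the simple vanishing of
`S(T)` into double vanishing unless `p` divides the leading coefficient `1 - 2 h T` exactly once. -/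
theorem sq_dvd_eval_truncSeries (hodd : Odd p) (hc : ClausenRecurrence h d c) (hc₀ : c 0 = 1)
    (hdeg : 2 * (truncSeries (ZMod p) c p).natDegree ≤ p) {T : ℤ_[p]}
    (hsing : (p : ℤ_[p]) ∣ 1 - 2 * (h : ℤ_[p]) * T → (p : ℤ_[p]) ^ 2 ∣ 1 - 2 * (h : ℤ_[p]) * T)
    (hT : (p : ℤ_[p]) ∣ (truncSeries ℤ_[p] c p).eval T) :
    (p : ℤ_[p]) ^ 2 ∣ (truncSeries ℤ_[p] c p).eval T := by
  by_cases hdvd : (p : ℤ_[p]) ∣ 1 - 2 * (h : ℤ_[p]) * T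
  · exact sq_dvd_eval_truncSeries_of_singular hc hc₀ hT hdeg (hsing hdvd)
  · exact sq_dvd_eval_truncSeries_of_regular hodd hc hc₀ hT hdvd

end Supercongruence

section Pullback

section CommRing

variable {R : Type*} [CommRing R]

/-- The quotient rule: with `v = 1 - m X` one has `theta v = v - 1`, so that each application of
`theta` costs one factor `v`. -/
lemma cube_mul_aperyOp {v q w : R[X]} (a b c : R) (hv : theta v = v - 1)
    (hw : v * theta w = q * w) : v ^ 3 * aperyOp a b c w =
      ((1 - 2 * C a * X + C c * X ^ 2) *
          (v * theta (v * theta q + (q + 1 - v) * q)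
            + (q + 2 * (1 - v)) * (v * theta q + (q + 1 - v) * q))
        - 3 * (C a * X - C c * X ^ 2) * v * (v * theta q + (q + 1 - v) * q)
        - (C a * X + 2 * C b * X - 3 * C c * X ^ 2) * v ^ 2 * q
        - (C b * X - C c * X ^ 2) * v ^ 3) * w := by
  set q₂ := v * theta q + (q + 1 - v) * q
  have hw₂ : v ^ 2 * theta (theta w) = q₂ * w := by
    have := congrArg theta hw
    simp only [Derivation.leibniz, smul_eq_mul, hv] at this
    linear_combination v * this + (q + 1 - v) * hw
  have hw₃ : v ^ 3 * theta (theta (theta w)) = (v * theta q₂ + (q + 2 * (1 - v)) * q₂) * w := by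
    have := congrArg theta hw₂
    simp only [Derivation.leibniz, Derivation.leibniz_pow, smul_eq_mul, nsmul_eq_mul, hv] at this
    linear_combination v * this + q₂ * hw + 2 * (1 - v) * hw₂
  rw [aperyOp]
  linear_combination (1 - 2 * C a * X + C c * X ^ 2) * hw₃
    - 3 * (C a * X - C c * X ^ 2) * v * hw₂
    - (C a * X + 2 * C b * X - 3 * C c * X ^ 2) * v ^ 2 * hw

/-- The polynomial `(s X^a)^k (1 - m X)^(p-1-Nk)`, which in characteristic `p` stands for
`(s X^a / (1 - m X)^N)^k / (1 - m X)`. The exponent is truncated at `0` when `p ≤ N k`; such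
terms only occur with coefficient `0`. -/
noncomputable def pullbackTerm (s m : R) (a N p k : ℕ) : R[X] :=
  (C s * X ^ a) ^ k * (1 - C m * X) ^ (p - 1 - N * k)

/-- In characteristic `p`, a polynomial form of `S(s X^a / (1 - m X)^N) / (1 - m X)`, where `S` is
the series with coefficients `c`. -/
noncomputable def pullback (c : ℕ → ℕ) (s m : R) (a N p : ℕ) : R[X] :=
  ∑ k ∈ Finset.range p, C (c k : R) * pullbackTerm s m a N p k

variable {c : ℕ → ℕ} {s m : R} {a N p k : ℕ}

lemma theta_one_sub_C_mul_X (m : R) : theta (1 - C m * X) = (1 - C m * X) - 1 := by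
  simp [Derivation.leibniz, theta_X]

lemma mul_theta_pullbackTerm [CharP R p] (s m : R) (a : ℕ) (hk : N * k < p) :
    (1 - C m * X) * theta (pullbackTerm s m a N p k) =
      ((a * k : R[X]) * (1 - C m * X) + (N * k + 1 : R[X]) * (C m * X))
        * pullbackTerm s m a N p k := by
  have hpow (y : R[X]) (n : ℕ) : y * theta (y ^ n) = (n : R[X]) * y ^ n * theta y := by
    cases n with
    | zero => simp
    | succ n =>
      rw [Derivation.leibniz_pow, Nat.add_sub_cancel, smul_eq_mul, nsmul_eq_mul]
      ring
  have hexp : ((p - 1 - N * k : ℕ) : R[X]) = -(N * k + 1) := by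
    have : ((p - 1 - N * k + (N * k + 1) : ℕ) : R[X]) = 0 := by
      rw [show p - 1 - N * k + (N * k + 1) = p by omega, CharP.cast_eq_zero]
    push_cast at this
    linear_combination this
  have hX : theta ((C s * X ^ a) ^ k) = (a * k : R[X]) * (C s * X ^ a) ^ k := by
    rw [mul_pow, ← pow_mul, ← C_pow, Derivation.leibniz, theta_C, smul_eq_mul, smul_zero,
      add_zero, theta_apply, derivative_X_pow]
    cases h : a * k with
    | zero => simp [← Nat.cast_mul, h]
    | succ n =>
      simp only [← Nat.cast_mul, h, Nat.add_sub_cancel, C_eq_natCast]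
      ring
  have hv := hpow (1 - C m * X) (p - 1 - N * k)
  rw [theta_one_sub_C_mul_X, hexp] at hv
  rw [pullbackTerm, Derivation.leibniz, hX, smul_eq_mul, smul_eq_mul]
  linear_combination (C s * X ^ a) ^ k * hv

lemma pow_mul_pullbackTerm_succ (s m : R) (a : ℕ) (hk : N * (k + 1) < p) :
    (1 - C m * X) ^ N * pullbackTerm s m a N p (k + 1) =
      C s * X ^ a * pullbackTerm s m a N p k := by
  have hexp : p - 1 - N * k = N + (p - 1 - N * (k + 1)) := by
    rw [mul_add_one] at hk ⊢
    omega
  rw [pullbackTerm, pullbackTerm, hexp, pow_add, pow_succ]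
  ring

variable [CharP R p]

lemma natCast_cube_mul_eq_zero (hvanish : ∀ k, p ≤ N * k → k < p → (c k : R) = 0)
    (hN : p ≤ N * k) (hk : k ≤ p) : ((k ^ 3 * c k : ℕ) : R) = 0 := by
  rcases hk.lt_or_eq with hlt | rfl
  · rw [Nat.cast_mul, hvanish k hN hlt, mul_zero]
  · simp

lemma pow_mul_natCast_mul_pullbackTerm_succ {h d : ℕ} (hc : ClausenRecurrence h d c)
    (hvanish : ∀ k, p ≤ N * k → k < p → (c k : R) = 0) (s m : R) (a : ℕ) (hk : k < p) :
    (1 - C m * X) ^ N *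
        (C (((k + 1) ^ 3 * c (k + 1) : ℕ) : R) * pullbackTerm s m a N p (k + 1)) =
      (2 * k + 1 : R[X]) * (h * k * (k + 1) + d : R[X]) * (c k : R[X]) *
        (C s * X ^ a * pullbackTerm s m a N p k) := by
  have hrec : C (((k + 1) ^ 3 * c (k + 1) : ℕ) : R) =
      (2 * k + 1) * (h * k * (k + 1) + d) * (c k : R[X]) := by
    rw [C_eq_natCast]
    exact_mod_cast congrArg (Nat.cast (R := R[X])) (hc k)
  rcases lt_or_ge (N * (k + 1)) p with hlt | hge
  · rw [← hrec, ← pow_mul_pullbackTerm_succ s m a hlt, mul_left_comm]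
  · rw [← hrec, natCast_cube_mul_eq_zero hvanish hge hk, C_0, zero_mul, mul_zero, zero_mul]

/-- By the recurrence, the image of the `k`-th term is a difference of consecutive values of
`k³ c_k (1 - m X)^N` times the `k`-th term, so the sum telescopes. -/
lemma aperyOp_pullback_eq_zero [IsDomain R] {h d : ℕ} {A B D : R} {W : R[X]}
    (hc : ClausenRecurrence h d c) (hvanish : ∀ k, p ≤ N * k → k < p → (c k : R) = 0)
    (hterm : ∀ k, N * k < p → (1 - C m * X) ^ 3 * aperyOp A B D (pullbackTerm s m a N p k) =
      W * ((k : R[X]) ^ 3 * (1 - C m * X) ^ N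
        - (2 * k + 1 : R[X]) * (h * k * (k + 1) + d : R[X]) * (C s * X ^ a))
        * pullbackTerm s m a N p k) :
    aperyOp A B D (pullback c s m a N p) = 0 := by
  let g (k : ℕ) : R[X] :=
    (1 - C m * X) ^ N * (C ((k ^ 3 * c k : ℕ) : R) * pullbackTerm s m a N p k)
  have hdiff (k : ℕ) (hk : k < p) : (1 - C m * X) ^ 3 *
      aperyOp A B D (C (c k : R) * pullbackTerm s m a N p k) = W * (g k - g (k + 1)) := by
    have hsucc : g (k + 1) = _ := pow_mul_natCast_mul_pullbackTerm_succ hc hvanish s m a hk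
    rw [aperyOp_C_mul, hsucc, C_eq_natCast]
    rcases lt_or_ge (N * k) p with hlt | hge
    · rw [mul_left_comm, hterm k hlt]
      simp only [g, Nat.cast_mul, Nat.cast_pow, C_mul, C_pow, C_eq_natCast]
      ring
    · have hck : (c k : R[X]) = 0 := by rw [← C_eq_natCast, hvanish k hge hk, C_0]
      simp [g, hck]
  have hsum : (1 - C m * X) ^ 3 * aperyOp A B D (pullback c s m a N p) = 0 := by
    rw [pullback, aperyOp_sum, Finset.mul_sum,
      Finset.sum_congr rfl fun k hk => hdiff k (Finset.mem_range.1 hk), ← Finset.mul_sum,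
      Finset.sum_range_sub']
    simp [g]
  refine (mul_eq_zero.1 hsum).resolve_left (pow_ne_zero 3 fun h => ?_)
  simpa using congrArg (eval 0) h

end CommRing

section Eval

variable {R : Type*} [CommRing R] {c : ℕ → ℕ} {p N : ℕ}

lemma eval_pullback (hvanish : ∀ k, p ≤ N * k → k < p → (c k : R) = 0)
    {s m u t : R} {a : ℕ} (ht : t * (1 - m * u) ^ N = s * u ^ a) :
    (pullback c s m a N p).eval u = (1 - m * u) ^ (p - 1) * (truncSeries R c p).eval t := by
  rw [pullback, eval_finsetSum, eval_truncSeries, Finset.mul_sum]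
  refine Finset.sum_congr rfl fun k hk => ?_
  rcases lt_or_ge (N * k) p with hlt | hge
  · have hexp : p - 1 = N * k + (p - 1 - N * k) := by omega
    have heval : (pullbackTerm s m a N p k).eval u =
        (t * (1 - m * u) ^ N) ^ k * (1 - m * u) ^ (p - 1 - N * k) := by
      simp [pullbackTerm, ht]
    rw [eval_mul, eval_C, heval, mul_pow, ← pow_mul]
    nth_rw 2 [hexp]
    rw [pow_add]
    ring
  · simp [hvanish k hge (Finset.mem_range.1 hk)]

lemma degree_pullback_lt (hp : p ≠ 0) (hvanish : ∀ k, p ≤ N * k → k < p → (c k : R) = 0)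
    (s m : R) {a : ℕ} (ha : a ≤ N) : (pullback c s m a N p).degree < p := by
  refine mem_degreeLT.1 (Submodule.sum_mem _ fun k hk => mem_degreeLT.2 ?_)
  rcases lt_or_ge (N * k) p with hlt | hge
  · have hak : a * k ≤ N * k := Nat.mul_le_mul_right k ha
    have hdeg : (C (c k : R) * pullbackTerm s m a N p k).natDegree ≤ p - 1 := by
      rw [pullbackTerm, mul_pow, ← pow_mul, ← C_pow]
      compute_degree
      omega
    exact (degree_le_of_natDegree_le hdeg).trans_lt (by exact_mod_cast Nat.pred_lt hp)
  · rw [hvanish k hge (Finset.mem_range.1 hk), C_0, zero_mul, degree_zero]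
    exact WithBot.bot_lt_coe p

variable {a₁ a₂ : ℕ}

lemma pullback_eq_pullback [IsDomain R] [CharP R p] (hp : p ≠ 0) (hc₀ : c 0 = 1)
    (hvanish : ∀ k, p ≤ N * k → k < p → (c k : R) = 0) {s₁ m₁ s₂ m₂ A B D : R}
    (ha₁ : a₁ ≤ N) (ha₂ : a₂ ≤ N) (ha₁' : a₁ ≠ 0) (ha₂' : a₂ ≠ 0)
    (h₁ : aperyOp A B D (pullback c s₁ m₁ a₁ N p) = 0)
    (h₂ : aperyOp A B D (pullback c s₂ m₂ a₂ N p) = 0) :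
    pullback c s₁ m₁ a₁ N p = pullback c s₂ m₂ a₂ N p := by
  have hcoeff {s m : R} {a : ℕ} (ha : a ≠ 0) : (pullback c s m a N p).coeff 0 = 1 := by
    rw [coeff_zero_eq_eval_zero, eval_pullback hvanish (t := 0) (by simp [ha]),
      eval_zero_truncSeries hc₀ hp]
    simp
  refine sub_eq_zero.1 (eq_zero_of_aperyOp_eq_zero (p := p) (a := A) (b := B) (c := D) ?_ ?_ ?_)
  · exact (degree_sub_le _ _).trans_lt (max_lt (degree_pullback_lt hp hvanish s₁ m₁ ha₁)
      (degree_pullback_lt hp hvanish s₂ m₂ ha₂))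
  · rw [coeff_sub, hcoeff ha₁', hcoeff ha₂', sub_self]
  · rw [aperyOp_sub, h₁, h₂, sub_self]

lemma eval_truncSeries_eq_zero_of_pullback_eq [IsDomain R]
    (hvanish : ∀ k, p ≤ N * k → k < p → (c k : R) = 0) {s₁ m₁ s₂ m₂ u t₁ t₂ : R}
    (heq : pullback c s₁ m₁ a₁ N p = pullback c s₂ m₂ a₂ N p)
    (ht₁ : t₁ * (1 - m₁ * u) ^ N = s₁ * u ^ a₁) (ht₂ : t₂ * (1 - m₂ * u) ^ N = s₂ * u ^ a₂)
    (hu : 1 - m₂ * u ≠ 0) (h₁ : (truncSeries R c p).eval t₁ = 0) :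
    (truncSeries R c p).eval t₂ = 0 := by
  have := congrArg (eval u) heq
  rw [eval_pullback hvanish ht₁, eval_pullback hvanish ht₂, h₁, mul_zero, eq_comm] at this
  exact (mul_eq_zero.1 this).resolve_left (pow_ne_zero _ hu)

end Eval

end Pullback

section Transformations

variable {R : Type*} [CommRing R] {p : ℕ} {c : ℕ → ℕ}

lemma theta_ofNat (n : ℕ) [n.AtLeastTwo] : theta (ofNat(n) : R[X]) = 0 := theta_C (ofNat(n) : R)

variable [IsDomain R] [CharP R p] {u t₁ t₂ : R}

lemma aperyOp_pullback_sq_div_cube (hc : ClausenRecurrence 54 12 c)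
    (hvanish : ∀ k, p ≤ 3 * k → k < p → (c k : R) = 0) :
    aperyOp (10 : R) 4 64 (pullback c 1 4 2 3 p) = 0 := by
  refine aperyOp_pullback_eq_zero (W := 8 * (1 + 2 * X) * (1 - 4 * X)) hc hvanish fun k hk => ?_
  rw [cube_mul_aperyOp _ _ _ (theta_one_sub_C_mul_X _) (mul_theta_pullbackTerm _ _ _ hk)]
  simp only [Derivation.leibniz, smul_eq_mul, map_add, map_sub, map_zero, theta_X,
    Derivation.map_one_eq_zero, Derivation.map_natCast, theta_ofNat, map_ofNat, map_one,
    Nat.cast_ofNat]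
  ring

lemma aperyOp_pullback_neg_div_cube (hc : ClausenRecurrence 54 12 c)
    (hvanish : ∀ k, p ≤ 3 * k → k < p → (c k : R) = 0) :
    aperyOp (10 : R) 4 64 (pullback c (-1) 16 1 3 p) = 0 := by
  refine aperyOp_pullback_eq_zero (W := (1 + 32 * X) * (1 - 16 * X)) hc hvanish fun k hk => ?_
  rw [cube_mul_aperyOp _ _ _ (theta_one_sub_C_mul_X _) (mul_theta_pullbackTerm _ _ _ hk)]
  simp only [Derivation.leibniz, smul_eq_mul, map_add, map_sub, map_neg, map_zero, theta_X,
    Derivation.map_one_eq_zero, Derivation.map_natCast, theta_ofNat, map_ofNat, map_one,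
    Nat.cast_ofNat, Nat.cast_one]
  ring

lemma aperyOp_pullback_cube_div_fourth (hc : ClausenRecurrence 128 24 c)
    (hvanish : ∀ k, p ≤ 4 * k → k < p → (c k : R) = 0) :
    aperyOp (-7 : R) (-3) 81 (pullback c 1 (-3) 3 4 p) = 0 := by
  refine aperyOp_pullback_eq_zero (W := 27 * (1 - X)) hc hvanish fun k hk => ?_
  rw [cube_mul_aperyOp _ _ _ (theta_one_sub_C_mul_X _) (mul_theta_pullbackTerm _ _ _ hk)]
  simp only [Derivation.leibniz, smul_eq_mul, map_add, map_sub, map_neg, map_zero, theta_X,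
    Derivation.map_one_eq_zero, Derivation.map_natCast, theta_ofNat, map_ofNat, map_one,
    Nat.cast_ofNat]
  ring

lemma aperyOp_pullback_div_fourth (hc : ClausenRecurrence 128 24 c)
    (hvanish : ∀ k, p ≤ 4 * k → k < p → (c k : R) = 0) :
    aperyOp (-7 : R) (-3) 81 (pullback c 1 (-27) 1 4 p) = 0 := by
  refine aperyOp_pullback_eq_zero (W := 1 - 81 * X) hc hvanish fun k hk => ?_
  rw [cube_mul_aperyOp _ _ _ (theta_one_sub_C_mul_X _) (mul_theta_pullbackTerm _ _ _ hk)]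
  simp only [Derivation.leibniz, smul_eq_mul, map_add, map_sub, map_neg, map_zero, theta_X,
    Derivation.map_one_eq_zero, Derivation.map_natCast, theta_ofNat, map_ofNat, map_one,
    Nat.cast_ofNat, Nat.cast_one]
  ring

theorem eval_truncSeries_neg_div_cube_eq_zero (hp : p ≠ 0) (hc : ClausenRecurrence 54 12 c)
    (hc₀ : c 0 = 1) (hvanish : ∀ k, p ≤ 3 * k → k < p → (c k : R) = 0)
    (ht₁ : t₁ * (1 - 4 * u) ^ 3 = u ^ 2) (ht₂ : t₂ * (1 - 16 * u) ^ 3 = -u)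
    (hu : 1 - 16 * u ≠ 0) (h₁ : (truncSeries R c p).eval t₁ = 0) :
    (truncSeries R c p).eval t₂ = 0 :=
  eval_truncSeries_eq_zero_of_pullback_eq hvanish
    (pullback_eq_pullback hp hc₀ hvanish (by norm_num) (by norm_num) two_ne_zero one_ne_zero
      (aperyOp_pullback_sq_div_cube hc hvanish) (aperyOp_pullback_neg_div_cube hc hvanish))
    (by rw [ht₁, one_mul]) (by rw [ht₂, pow_one, neg_one_mul]) hu h₁

theorem eval_truncSeries_div_fourth_eq_zero (hp : p ≠ 0) (hc : ClausenRecurrence 128 24 c)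
    (hc₀ : c 0 = 1) (hvanish : ∀ k, p ≤ 4 * k → k < p → (c k : R) = 0)
    (ht₁ : t₁ * (1 + 3 * u) ^ 4 = u ^ 3) (ht₂ : t₂ * (1 + 27 * u) ^ 4 = u)
    (hu : 1 + 27 * u ≠ 0) (h₁ : (truncSeries R c p).eval t₁ = 0) :
    (truncSeries R c p).eval t₂ = 0 :=
  eval_truncSeries_eq_zero_of_pullback_eq hvanish
    (pullback_eq_pullback hp hc₀ hvanish (by norm_num) (by norm_num) three_ne_zero one_ne_zero
      (aperyOp_pullback_cube_div_fourth hc hvanish) (aperyOp_pullback_div_fourth hc hvanish))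
    (by rw [neg_mul, sub_neg_eq_add, ht₁, one_mul])
    (by rw [neg_mul, sub_neg_eq_add, ht₂, pow_one, one_mul])
    (by rwa [neg_mul, sub_neg_eq_add]) h₁

end Transformations

section Coefficients

variable {c : ℕ → ℕ} {p N : ℕ}

lemma mul_natDegree_truncSeries_le {R : Type*} [CommRing R]
    (hvanish : ∀ k, p ≤ N * k → k < p → (c k : R) = 0) :
    N * (truncSeries R c p).natDegree ≤ p := by
  by_contra! hlt
  have hne : truncSeries R c p ≠ 0 := by
    intro h
    simp [h] at hlt
  refine hne (leadingCoeff_eq_zero.1 ?_)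
  rw [leadingCoeff, coeff_truncSeries]
  split_ifs with hdeg
  · exact hvanish _ hlt.le hdeg
  · rfl

/-- The coefficients of `cubicSum`. -/
def cubicCoeff (k : ℕ) : ℕ := (2 * k).choose k ^ 2 * (3 * k).choose k

/-- The coefficients of `quarticSum`. -/
def quarticCoeff (k : ℕ) : ℕ := (2 * k).choose k ^ 2 * (4 * k).choose (2 * k)

lemma cubicCoeff_zero : cubicCoeff 0 = 1 := rfl

lemma quarticCoeff_zero : quarticCoeff 0 = 1 := rfl

lemma choose_two_mul_mul_factorial_sq (k : ℕ) :
    (2 * k).choose k * k.factorial ^ 2 = (2 * k).factorial := by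
  rw [← Nat.choose_mul_factorial_mul_factorial (show k ≤ 2 * k by omega),
    show 2 * k - k = k by omega]
  ring

lemma cubicCoeff_mul_factorial_pow (k : ℕ) :
    cubicCoeff k * k.factorial ^ 5 = (2 * k).factorial * (3 * k).factorial := by
  have h₃ := Nat.choose_mul_factorial_mul_factorial (show k ≤ 3 * k by omega)
  rw [show 3 * k - k = 2 * k by omega] at h₃
  rw [cubicCoeff, ← h₃, ← choose_two_mul_mul_factorial_sq]
  ring

lemma quarticCoeff_mul_factorial_pow (k : ℕ) :
    quarticCoeff k * k.factorial ^ 4 = (4 * k).factorial := by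
  have h₄ := choose_two_mul_mul_factorial_sq (2 * k)
  rw [show 2 * (2 * k) = 4 * k by ring] at h₄
  rw [quarticCoeff, ← h₄, ← choose_two_mul_mul_factorial_sq]
  ring

lemma cubicCoeff_recurrence : ClausenRecurrence 54 12 cubicCoeff := by
  intro k
  have hk := cubicCoeff_mul_factorial_pow k
  have hk₁ := cubicCoeff_mul_factorial_pow (k + 1)
  have h₂ : (2 * (k + 1)).factorial = (2 * k + 2) * ((2 * k + 1) * (2 * k).factorial) := by
    rw [mul_add_one, Nat.factorial_succ, Nat.factorial_succ]
  have h₃ : (3 * (k + 1)).factorial =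
      (3 * k + 3) * ((3 * k + 2) * ((3 * k + 1) * (3 * k).factorial)) := by
    rw [mul_add_one, Nat.factorial_succ, Nat.factorial_succ, Nat.factorial_succ]
  rw [Nat.factorial_succ, h₂, h₃] at hk₁
  refine mul_right_cancel₀ (b := (k + 1) ^ 2 * k.factorial ^ 5)
    (mul_ne_zero (by positivity) (pow_ne_zero _ k.factorial_ne_zero)) ?_
  zify at hk hk₁ ⊢
  linear_combination hk₁ - (6 * (k + 1) ^ 2 * (2 * k + 1) * (3 * k + 1) * (3 * k + 2) : ℤ) * hk

lemma quarticCoeff_recurrence : ClausenRecurrence 128 24 quarticCoeff := by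
  intro k
  have hk := quarticCoeff_mul_factorial_pow k
  have hk₁ := quarticCoeff_mul_factorial_pow (k + 1)
  have h₄ : (4 * (k + 1)).factorial =
      (4 * k + 4) * ((4 * k + 3) * ((4 * k + 2) * ((4 * k + 1) * (4 * k).factorial))) := by
    rw [mul_add_one, Nat.factorial_succ, Nat.factorial_succ, Nat.factorial_succ,
      Nat.factorial_succ]
  rw [Nat.factorial_succ, h₄] at hk₁
  refine mul_right_cancel₀ (b := (k + 1) * k.factorial ^ 4)
    (mul_ne_zero (by positivity) (pow_ne_zero _ k.factorial_ne_zero)) ?_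
  zify at hk hk₁ ⊢
  linear_combination hk₁ - (4 * (k + 1) * (4 * k + 1) * (4 * k + 2) * (4 * k + 3) : ℤ) * hk

lemma dvd_of_dvd_mul_factorial_pow (hp : p.Prime) {a k i : ℕ} (hk : k < p)
    (h : p ∣ a * k.factorial ^ i) : p ∣ a :=
  (hp.dvd_mul.1 h).resolve_right fun h' => hk.not_ge (hp.dvd_factorial.1 (hp.dvd_of_dvd_pow h'))

variable (R : Type*) [CommRing R] [CharP R p]

lemma cast_cubicCoeff_eq_zero (hp : p.Prime) (k : ℕ) (h : p ≤ 3 * k) (hk : k < p) :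
    (cubicCoeff k : R) = 0 := by
  rw [CharP.cast_eq_zero_iff R p]
  refine dvd_of_dvd_mul_factorial_pow hp hk (i := 5) ?_
  rw [cubicCoeff_mul_factorial_pow]
  exact (hp.dvd_factorial.2 h).mul_left _

lemma cast_quarticCoeff_eq_zero_iff (hp : p.Prime) {k : ℕ} (hk : k < p) :
    (quarticCoeff k : R) = 0 ↔ p ≤ 4 * k := by
  rw [CharP.cast_eq_zero_iff R p, ← hp.dvd_factorial, ← quarticCoeff_mul_factorial_pow]
  exact ⟨fun h => h.mul_right _, dvd_of_dvd_mul_factorial_pow hp hk⟩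

lemma natDegree_truncSeries_quarticCoeff (hp : p.Prime) :
    (truncSeries R quarticCoeff p).natDegree = p / 4 := by
  have hpos := hp.pos
  refine le_antisymm ?_ (le_natDegree_of_ne_zero ?_)
  · have := mul_natDegree_truncSeries_le (R := R) (N := 4) fun k h hk =>
      (cast_quarticCoeff_eq_zero_iff R hp hk).2 h
    omega
  · have hlt : p / 4 < p := by omega
    rw [coeff_truncSeries, if_pos hlt, Ne, cast_quarticCoeff_eq_zero_iff R hp hlt, not_le]
    refine lt_of_le_of_ne (Nat.mul_div_le p 4) fun h => ?_
    have := hp.eq_one_or_self_of_dvd 4 (Dvd.intro _ h)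
    have := hp.eq_one_or_self_of_dvd 2 ⟨2 * (p / 4), by omega⟩
    omega

end Coefficients

section PadicInt

variable {p : ℕ} [Fact p.Prime] {U T₁ T₂ : ℤ_[p]}

theorem sq_dvd_eval_truncSeries_cubicCoeff (hodd : Odd p)
    (hU₁ : ¬ (p : ℤ_[p]) ∣ 1 - 4 * U) (hU₂ : ¬ (p : ℤ_[p]) ∣ 1 - 16 * U)
    (hT₁ : T₁ * (1 - 4 * U) ^ 3 = U ^ 2) (hT₂ : T₂ * (1 - 16 * U) ^ 3 = -U)
    (h : (p : ℤ_[p]) ∣ (truncSeries ℤ_[p] cubicCoeff p).eval T₁) :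
    (p : ℤ_[p]) ^ 2 ∣ (truncSeries ℤ_[p] cubicCoeff p).eval T₂ := by
  have hp : p.Prime := Fact.out
  have hπ : Prime (p : ℤ_[p]) := PadicInt.prime_p
  have hvanish := cast_cubicCoeff_eq_zero (ZMod p) hp
  have hdeg := mul_natDegree_truncSeries_le hvanish
  have hsymb : (1 - 2 * ((54 : ℕ) : ℤ_[p]) * T₂) * (1 - 16 * U) ^ 3 =
      (1 + 32 * U) ^ 2 * (1 - 4 * U) := by
    push_cast
    linear_combination -108 * hT₂
  refine sq_dvd_eval_truncSeries hodd cubicCoeff_recurrence cubicCoeff_zero (by omega)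
    (fun hdvd => ?_) ?_
  · have hroot : (p : ℤ_[p]) ∣ 1 + 32 * U :=
      hπ.dvd_of_dvd_pow ((hπ.dvd_or_dvd (hsymb ▸ hdvd.mul_right _)).resolve_right hU₁)
    exact hπ.pow_dvd_of_dvd_mul_right 2 (mt hπ.dvd_of_dvd_pow hU₂)
      (hsymb ▸ (pow_dvd_pow_of_dvd hroot 2).mul_right _)
  · rw [← toZMod_eq_zero_iff_dvd] at hU₂
    refine (dvd_eval_theta_iterate_iff cubicCoeff 0 T₂).2 ?_
    refine eval_truncSeries_neg_div_cube_eq_zero (u := PadicInt.toZMod U) hp.ne_zero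
      cubicCoeff_recurrence cubicCoeff_zero hvanish ?_ ?_ ?_
      ((dvd_eval_theta_iterate_iff cubicCoeff 0 T₁).1 h)
    · simpa only [map_mul, map_pow, map_sub, map_one, map_ofNat] using congrArg PadicInt.toZMod hT₁
    · simpa only [map_mul, map_pow, map_sub, map_neg, map_one, map_ofNat] using
        congrArg PadicInt.toZMod hT₂
    · simpa only [map_mul, map_sub, map_one, map_ofNat] using hU₂

lemma odd_div_four_of_eval_eq_zero {t : ZMod p} (ht : 256 * t = 1)
    (h : (truncSeries (ZMod p) quarticCoeff p).eval t = 0) : Odd (p / 4) := by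
  have hp : p.Prime := Fact.out
  let f := algebraMap (ZMod p) (AlgebraicClosure (ZMod p))
  have : CharP (AlgebraicClosure (ZMod p)) p := charP_of_injective_algebraMap f.injective p
  set y := truncSeries (AlgebraicClosure (ZMod p)) quarticCoeff p
  have hdeg : y.natDegree = p / 4 := natDegree_truncSeries_quarticCoeff _ hp
  rw [← hdeg]
  refine odd_natDegree_of_eval_eq_zero (r := f t) hp (IsAlgClosed.splits y) (by omega)
    (quarticCoeff_recurrence.aperyOp_truncSeries_of_charP p)
    (quarticCoeff_recurrence.firstIntegral_eq_zero hp) ?_ ?_ ?_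
  · rw [eval_zero_truncSeries quarticCoeff_zero hp.ne_zero]
    exact one_ne_zero
  · rw [← map_one f, ← ht, map_mul, map_ofNat]
    norm_num
  · rw [← map_zero f, ← h]
    exact (map_eval_theta_iterate_truncSeries f quarticCoeff p 0 t).symm

lemma even_div_four_of_quadratic_eq_zero (hodd : Odd p) {x : ZMod p}
    (hx : 1 + 14 * x + 81 * x ^ 2 = 0) : Even (p / 4) := by
  have hp₂ : p ≠ 2 := by
    rintro rfl
    exact absurd hodd (by decide)
  have h₂ : (2 : ZMod p) ≠ 0 := Ring.two_ne_zero (by rwa [ZMod.ringChar_zmod_n])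
  have hsq : IsSquare (-2 : ZMod p) := by
    refine ⟨(81 * x + 7) / 2 ^ 2, ?_⟩
    field_simp
    linear_combination -81 * hx
  have := (ZMod.exists_sq_eq_neg_two_iff hp₂).1 hsq
  rw [Nat.even_iff]
  omega

theorem sq_dvd_eval_truncSeries_quarticCoeff (hodd : Odd p)
    (hU : ¬ (p : ℤ_[p]) ∣ 1 + 27 * U) (hT₁ : T₁ * (1 + 3 * U) ^ 4 = U ^ 3)
    (hT₂ : T₂ * (1 + 27 * U) ^ 4 = U)
    (h : (p : ℤ_[p]) ∣ (truncSeries ℤ_[p] quarticCoeff p).eval T₁) :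
    (p : ℤ_[p]) ^ 2 ∣ (truncSeries ℤ_[p] quarticCoeff p).eval T₂ := by
  have hp : p.Prime := Fact.out
  have hπ : Prime (p : ℤ_[p]) := PadicInt.prime_p
  have hdeg := natDegree_truncSeries_quarticCoeff (ZMod p) hp
  have hsymb : (1 - 2 * ((128 : ℕ) : ℤ_[p]) * T₂) * (1 + 27 * U) ^ 4 =
      (1 - 81 * U) ^ 2 * (1 + 14 * U + 81 * U ^ 2) := by
    push_cast
    linear_combination -256 * hT₂
  have hroot : (truncSeries (ZMod p) quarticCoeff p).eval (PadicInt.toZMod T₂) = 0 := by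
    rw [← toZMod_eq_zero_iff_dvd] at hU
    refine eval_truncSeries_div_fourth_eq_zero (u := PadicInt.toZMod U) hp.ne_zero
      quarticCoeff_recurrence quarticCoeff_zero
      (fun k hpk hk => (cast_quarticCoeff_eq_zero_iff _ hp hk).2 hpk) ?_ ?_ ?_
      ((dvd_eval_theta_iterate_iff quarticCoeff 0 T₁).1 h)
    · simpa only [map_mul, map_pow, map_add, map_one, map_ofNat] using congrArg PadicInt.toZMod hT₁
    · simpa only [map_mul, map_pow, map_add, map_one, map_ofNat] using congrArg PadicInt.toZMod hT₂
    · simpa only [map_mul, map_add, map_one, map_ofNat] using hU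
  refine sq_dvd_eval_truncSeries hodd quarticCoeff_recurrence quarticCoeff_zero (by omega)
    (fun hdvd => ?_) ((dvd_eval_theta_iterate_iff quarticCoeff 0 T₂).2 hroot)
  rcases hπ.dvd_or_dvd (hsymb ▸ hdvd.mul_right _) with hsq | hquad
  · exact hπ.pow_dvd_of_dvd_mul_right 2 (mt hπ.dvd_of_dvd_pow hU)
      (hsymb ▸ (pow_dvd_pow_of_dvd (hπ.dvd_of_dvd_pow hsq) 2).mul_right _)
  · rw [← toZMod_eq_zero_iff_dvd] at hdvd hquad
    simp only [map_sub, map_add, map_mul, map_pow, map_one, map_ofNat, map_natCast] at hdvd hquad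
    exact absurd (even_div_four_of_quadratic_eq_zero hodd hquad) <|
      Nat.not_even_iff_odd.2 (odd_div_four_of_eval_eq_zero (by linear_combination -hdvd) hroot)

end PadicInt

section Localization

variable {p : ℕ} [Fact p.Prime] {m : ℕ} {x y : ℚ} {X Y : ℤ_[p]}

@[simp]
lemma coe_padicInt_ofNat (n : ℕ) [n.AtLeastTwo] :
    ((ofNat(n) : ℤ_[p]) : ℚ_[p]) = ofNat(n) := rfl

lemma pIntegral_iff_exists_padicInt : PIntegral p x ↔ ∃ X : ℤ_[p], (X : ℚ_[p]) = x := by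
  constructor
  · exact fun h => ⟨⟨x, Padic.norm_rat_le_one h⟩, rfl⟩
  · rintro ⟨X, hX⟩ hdvd
    have hden : IsUnit (x.den : ℤ_[p]) := PadicInt.isUnit_den x (hX ▸ X.norm_le_one)
    exact PadicInt.prime_p.not_isUnit (isUnit_of_dvd_unit (Nat.cast_dvd_cast hdvd) hden)

lemma pCong_iff_dvd_sub (hm : m ≠ 0) (hX : (X : ℚ_[p]) = x) (hY : (Y : ℚ_[p]) = y) :
    PCong p m x y ↔ (m : ℤ_[p]) ∣ X - Y := by
  constructor
  · rintro ⟨c, hc, hxy⟩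
    obtain ⟨C, hC⟩ := pIntegral_iff_exists_padicInt.1 hc
    refine ⟨C, PadicInt.ext ?_⟩
    rw [PadicInt.coe_sub, PadicInt.coe_mul, PadicInt.coe_natCast, hX, hY, hC]
    exact_mod_cast congrArg (Rat.cast (K := ℚ_[p])) hxy
  · rintro ⟨C, hC⟩
    have hmQ : (m : ℚ) ≠ 0 := Nat.cast_ne_zero.2 hm
    refine ⟨(x - y) / m, pIntegral_iff_exists_padicInt.2 ⟨C, ?_⟩, (mul_div_cancel₀ _ hmQ).symm⟩
    have hsub : (X : ℚ_[p]) - Y = m * C := congrArg Subtype.val hC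
    rw [Rat.cast_div, Rat.cast_sub, Rat.cast_natCast, eq_div_iff (Nat.cast_ne_zero.2 hm), ← hX,
      ← hY, hsub, mul_comm]

lemma exists_padicInt_eq_div (hX : (X : ℚ_[p]) = x) (hY : (Y : ℚ_[p]) = y)
    (hdvd : ¬ (p : ℤ_[p]) ∣ Y) : ∃ T : ℤ_[p], (T : ℚ_[p]) = (x / y : ℚ) ∧ T * Y = X := by
  obtain ⟨V, rfl⟩ : IsUnit Y := by
    rwa [← not_not (a := IsUnit Y), PadicInt.not_isUnit_iff, PadicInt.norm_lt_one_iff_dvd]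
  have hmul : X * ↑V⁻¹ * V = X := Units.inv_mul_cancel_right X V
  have hV₀ : (V : ℚ_[p]) ≠ 0 := PadicInt.coe_ne_zero.2 V.ne_zero
  refine ⟨X * ↑V⁻¹, ?_, hmul⟩
  rw [Rat.cast_div, ← hX, ← hY, eq_div_iff hV₀, ← PadicInt.coe_mul, hmul]

lemma not_dvd_one_sub_mul_of_not_pCong {n : ℤ} (hny : n * y = 1) (hX : (X : ℚ_[p]) = x)
    (h : ¬ PCong p p x y) : ¬ (p : ℤ_[p]) ∣ 1 - n * X := by
  intro hdvd
  have hn : ¬ (p : ℤ_[p]) ∣ n := fun hn => PadicInt.prime_p.not_dvd_one <| by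
    simpa only [sub_add_cancel] using hdvd.add (hn.mul_right X)
  obtain ⟨Y, hY, hYn⟩ := exists_padicInt_eq_div (X := 1) (x := 1) (y := n) (by simp) (by simp) hn
  rw [← eq_one_div_of_mul_eq_one_right hny] at hY
  have hfactor : X - Y = -Y * (1 - n * X) := by linear_combination -X * hYn
  exact h ((pCong_iff_dvd_sub (Nat.Prime.ne_zero Fact.out) hX hY).2 (hfactor ▸ hdvd.mul_left _))

lemma pCong_cubicSum_iff (hm : m ≠ 0) (hX : (X : ℚ_[p]) = x) :
    PCong p m (cubicSum p x) 0 ↔ (m : ℤ_[p]) ∣ (truncSeries ℤ_[p] cubicCoeff p).eval X := by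
  rw [pCong_iff_dvd_sub (Y := 0) hm ?_ (by simp), sub_zero]
  simp [eval_truncSeries, cubicSum, cubicCoeff, PadicInt.coe_sum, hX]

lemma pCong_quarticSum_iff (hm : m ≠ 0) (hX : (X : ℚ_[p]) = x) :
    PCong p m (quarticSum p x) 0 ↔ (m : ℤ_[p]) ∣ (truncSeries ℤ_[p] quarticCoeff p).eval X := by
  rw [pCong_iff_dvd_sub (Y := 0) hm ?_ (by simp), sub_zero]
  simp [eval_truncSeries, quarticSum, quarticCoeff, PadicInt.coe_sum, hX]

end Localization

theorem theorem2p4 (p : ℕ) (hp : p.Prime) (hodd : Odd p) (u : ℚ) (hu : PIntegral p u) :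
    (¬ PCong p p u (1 / 4) → ¬ PCong p p u (1 / 16) →
      PCong p p (cubicSum p (u ^ 2 / (1 - 4 * u) ^ 3)) 0 →
      PCong p (p ^ 2) (cubicSum p (-u / (1 - 16 * u) ^ 3)) 0) ∧
    (¬ PCong p p u (-1 / 3) → ¬ PCong p p u (-1 / 27) →
      PCong p p (quarticSum p (u ^ 3 / (1 + 3 * u) ^ 4)) 0 →
      PCong p (p ^ 2) (quarticSum p (u / (1 + 27 * u) ^ 4)) 0) := by
  have : Fact p.Prime := ⟨hp⟩
  obtain ⟨U, hU⟩ := pIntegral_iff_exists_padicInt.1 hu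
  refine ⟨fun h₁ h₂ hsum => ?_, fun h₁ h₂ hsum => ?_⟩
  · have hU₁ : ¬ (p : ℤ_[p]) ∣ 1 - 4 * U := by
      simpa using not_dvd_one_sub_mul_of_not_pCong (n := 4) (by norm_num) hU h₁
    have hU₂ : ¬ (p : ℤ_[p]) ∣ 1 - 16 * U := by
      simpa using not_dvd_one_sub_mul_of_not_pCong (n := 16) (by norm_num) hU h₂
    obtain ⟨T₁, hT₁, hmul₁⟩ := exists_padicInt_eq_div (X := U ^ 2) (Y := (1 - 4 * U) ^ 3)
      (x := u ^ 2) (y := (1 - 4 * u) ^ 3)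
      (by simp [hU]) (by simp [hU]) (mt PadicInt.prime_p.dvd_of_dvd_pow hU₁)
    obtain ⟨T₂, hT₂, hmul₂⟩ := exists_padicInt_eq_div (X := -U) (Y := (1 - 16 * U) ^ 3)
      (x := -u) (y := (1 - 16 * u) ^ 3)
      (by simp [hU]) (by simp [hU]) (mt PadicInt.prime_p.dvd_of_dvd_pow hU₂)
    rw [pCong_cubicSum_iff hp.ne_zero hT₁] at hsum
    rw [pCong_cubicSum_iff (pow_ne_zero 2 hp.ne_zero) hT₂, Nat.cast_pow]
    exact sq_dvd_eval_truncSeries_cubicCoeff hodd hU₁ hU₂ hmul₁ hmul₂ hsum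
  · have hU₁ : ¬ (p : ℤ_[p]) ∣ 1 + 3 * U := by
      simpa using not_dvd_one_sub_mul_of_not_pCong (n := -3) (by norm_num) hU h₁
    have hU₂ : ¬ (p : ℤ_[p]) ∣ 1 + 27 * U := by
      simpa using not_dvd_one_sub_mul_of_not_pCong (n := -27) (by norm_num) hU h₂
    obtain ⟨T₁, hT₁, hmul₁⟩ := exists_padicInt_eq_div (X := U ^ 3) (Y := (1 + 3 * U) ^ 4)
      (x := u ^ 3) (y := (1 + 3 * u) ^ 4)
      (by simp [hU]) (by simp [hU]) (mt PadicInt.prime_p.dvd_of_dvd_pow hU₁)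
    obtain ⟨T₂, hT₂, hmul₂⟩ := exists_padicInt_eq_div (X := U) (Y := (1 + 27 * U) ^ 4)
      (x := u) (y := (1 + 27 * u) ^ 4)
      (by simp [hU]) (by simp [hU]) (mt PadicInt.prime_p.dvd_of_dvd_pow hU₂)
    rw [pCong_quarticSum_iff hp.ne_zero hT₁] at hsum
    rw [pCong_quarticSum_iff (pow_ne_zero 2 hp.ne_zero) hT₂, Nat.cast_pow]
    exact sq_dvd_eval_truncSeries_quarticCoeff hodd hU₂ hmul₁ hmul₂ hsum
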